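/- For a ring $R$, let the commuting graph $\Gamma(R)$ be the simple undirected graph whose vertices are the non-central elements of $R$, two distinct vertices $a,b$ being adjacent if and only if $ab=ba$. For a graph $G$ and vertices $u,v$, let $d(u,v)$ be the length of a shortest path from $u$ to $v$, with $d(u,v)=\infty$ if there is no such path, and let $\operatorname{diam}(G)=\sup\{d(u,v) : u,v \text{ distinct vertices of } G\}\in\mathbb{N}\cup\{\infty\}$. Theorem. Let $\mathrm{M}_4(\mathbb{R})$ be the ring of real $4\times 4$ matrices; the vertices of $\Gamma(\mathrm{M}_4(\mathbb{R}))$ are thus the non-scalar real $4\times 4$ matrices. Then $$\operatorname{diam}\bigl(\Gamma(\mathrm{M}_4(\mathbb{R}))\bigr)=4.$$ -/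

import Mathlib

/-- The commuting graph `Γ(R)` of a ring `R`: the vertices are the non-central elements of `R`, and
two distinct vertices are adjacent if and only if they commute. -/
def commutingGraph (R : Type*) [Ring R] : SimpleGraph {x : R // x ∉ Set.center R} where
  Adj a b := a ≠ b ∧ (a : R) * (b : R) = (b : R) * (a : R)
  symm := ⟨fun _ _ h => ⟨h.1.symm, h.2.symm⟩⟩
  loopless := ⟨fun _ h => h.1 rfl⟩

open Matrix Polynomial

/-! Upper bound: real irreducible polynomials have degree at most two, so every non-scalar matrix
commutes with a non-scalar quadratic one. It remains to join two quadratic matrices X, Y through a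
common non-scalar C (`exists_commute_of_quadratic`). After shifts X² and Y² are scalar, and XY + YX
commutes with both. If it is scalar too, 1, X, Y, XY span an algebra whose Casimir operator sends
every T into the commutant. If all its values are scalar, rank-one T force XY into the span of 1, X,
Y, and a second operator of this kind supplies C. Lower bound: for the two explicit matrices below,
no chain with two non-scalar intermediate matrices exists (`eq_smul_one_of_commute_chain`). -/

theorem mem_center_iff_exists_smul_one {X : Matrix (Fin 4) (Fin 4) ℝ} :
    X ∈ Set.center (Matrix (Fin 4) (Fin 4) ℝ) ↔ ∃ c : ℝ, X = c • 1 := by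
  have := Algebra.IsCentral.mem_center_iff (K := ℝ) (D := Matrix (Fin 4) (Fin 4) ℝ) (x := X)
  simp only [Algebra.algebraMap_eq_smul_one] at this
  exact this

/-! ### Reduction to quadratic elements. -/

/-- Every non-central element of a real algebra that is algebraic commutes with a non-central
element satisfying a monic quadratic equation. -/
theorem exists_commute_quadratic {R : Type*} [Ring R] [Algebra ℝ R] [Nontrivial R] (A : R)
    (hA : IsIntegral ℝ A) (hs : ∀ c : ℝ, A ≠ c • 1) :
    ∃ X : R, (∀ c : ℝ, X ≠ c • 1) ∧ A * X = X * A ∧ ∃ a b : ℝ, X * X = a • X + b • 1 := by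
  have hm0 : minpoly ℝ A ≠ 0 := minpoly.ne_zero hA
  have key : ∀ f : ℝ[X], aeval A f = 0 ↔ minpoly ℝ A ∣ f := fun f => (minpoly.dvd_iff).symm
  have hcomm : ∀ f : ℝ[X], A * aeval A f = aeval A f * A := fun f => by
    have := congrArg (aeval A) (mul_comm (Polynomial.X : ℝ[X]) f)
    simpa using this
  obtain ⟨p, hp, g, hg⟩ := WfDvdMonoid.exists_irreducible_factor
    (minpoly.not_isUnit ℝ A) hm0
  have hg0 : g ≠ 0 := by rintro rfl; simp at hg; exact hm0 hg
  -- With minimal polynomial `p * g`: if `g` is a unit, `A` itself is quadratic; if `p ∣ g`, `g(A)`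
  -- squares to zero; otherwise Bézout gives a nontrivial idempotent.
  by_cases hu : IsUnit g
  · have hq : aeval A p = 0 := by
      rw [key]
      exact hg ▸ (associated_mul_unit_right p g hu).symm.dvd
    have hd : p.natDegree ≤ 2 := natDegree_le_of_degree_le hp.degree_le_two
    have h := eq_quadratic_of_degree_le_two hp.degree_le_two
    rw [h] at hq
    simp only [map_add, map_mul, map_pow, aeval_C, aeval_X, Algebra.algebraMap_eq_smul_one,
      smul_mul_assoc, one_mul] at hq
    have h2 : p.coeff 2 ≠ 0 := by
      intro h2
      rw [h2, zero_smul, zero_add] at hq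
      by_cases h1 : p.coeff 1 = 0
      · rw [h1, zero_smul, zero_add] at hq
        have h0 : p.coeff 0 = 0 := by simpa using hq
        rw [h2, h1, h0] at h
        exact hp.ne_zero (by simpa using h)
      · refine hs (-(p.coeff 1)⁻¹ * p.coeff 0) ?_
        have : A = (p.coeff 1)⁻¹ • (p.coeff 1 • A) := by rw [smul_smul, inv_mul_cancel₀ h1, one_smul]
        rw [this, eq_neg_of_add_eq_zero_left hq]
        module
    refine ⟨A, hs, rfl, -(p.coeff 2)⁻¹ * p.coeff 1, -(p.coeff 2)⁻¹ * p.coeff 0, ?_⟩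
    have : A * A = (p.coeff 2)⁻¹ • (p.coeff 2 • A ^ 2) := by
      rw [smul_smul, inv_mul_cancel₀ h2, one_smul, sq]
    rw [add_assoc] at hq
    rw [this, eq_neg_of_add_eq_zero_left hq]
    module
  by_cases hpg : p ∣ g
  · have hN : aeval A g * aeval A g = 0 := by
      rw [← map_mul, key, hg]
      exact mul_dvd_mul hpg dvd_rfl
    have hN0 : aeval A g ≠ 0 := by
      rw [Ne, key, hg]
      intro h
      have : p * g ∣ 1 * g := by simpa using h
      exact hp.not_isUnit (isUnit_of_dvd_one ((mul_dvd_mul_iff_right hg0).1 this))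
    refine ⟨aeval A g, fun c hc => ?_, hcomm g, 0, 0, by simpa using hN⟩
    rw [hc] at hN hN0
    simp at hN hN0
    exact hN0 hN
  · obtain ⟨u, v, huv⟩ := (hp.coprime_iff_not_dvd.2 hpg)
    have hE : aeval A (v * g) * aeval A (v * g) = aeval A (v * g) := by
      rw [← sub_eq_zero, ← map_mul, ← map_sub, key, hg]
      refine ⟨-(u * v), ?_⟩
      linear_combination (v * g) * huv
    have hE0 : aeval A (v * g) ≠ 0 := by
      rw [Ne, key, hg]
      intro h
      have h1 : p ∣ v * g := (dvd_mul_right p g).trans h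
      have h2 : p ∣ 1 := huv ▸ dvd_add (dvd_mul_left p u) h1
      exact hp.not_isUnit (isUnit_of_dvd_one h2)
    have hE1 : aeval A (v * g) ≠ 1 := by
      intro h
      have h' : aeval A (u * p) = 0 := by
        have := congrArg (aeval A) huv
        rw [map_add, h, map_one] at this
        simpa using this
      rw [key, hg] at h'
      have h1 : g ∣ u * p := (dvd_mul_left g p).trans h'
      exact hu (isUnit_of_dvd_one (huv ▸ dvd_add h1 (dvd_mul_left g v)))
    refine ⟨aeval A (v * g), fun c hc => ?_, hcomm _, 1, 0, by simpa using hE⟩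
    rw [hc] at hE hE0 hE1
    have h : (c * c - c) • (1 : R) = 0 := by
      rw [sub_smul, ← hE]; simp [smul_smul]
    rcases smul_eq_zero.1 h with h | h
    · have : c * (c - 1) = 0 := by linarith
      rcases mul_eq_zero.1 this with h | h
      · exact hE0 (by simp [h])
      · exact hE1 (by rw [sub_eq_zero.1 h, one_smul])
    · exact one_ne_zero h

/-! ### Common commutant of two quadratic matrices. -/

theorem mul_vecMulVec_mul_mulVec {n R : Type*} [Fintype n] [CommRing R] (X Y : Matrix n n R)
    (p q w : n → R) :
    (X * vecMulVec p q * Y) *ᵥ w = (q ⬝ᵥ (Y *ᵥ w)) • (X *ᵥ p) := by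
  rw [← mulVec_mulVec, ← mulVec_mulVec, vecMulVec_mulVec, mulVec_smul]
  simp

/-- In an algebra generated by `X`, `Y` with `X²`, `Y²` and `XY + YX` scalar, the Casimir element
maps everything into the commutant. -/
theorem casimir_commute {R : Type*} [Ring R] [Algebra ℝ R] {X Y : R} {a b c : ℝ}
    (hX : X * X = a • 1) (hY : Y * Y = b • 1) (hc : X * Y + Y * X = c • 1) (T : R) :
    X * (X * Y * T - X * T * Y + Y * T * X - T * (Y * X)) =
      (X * Y * T - X * T * Y + Y * T * X - T * (Y * X)) * X ∧
    Y * (X * Y * T - X * T * Y + Y * T * X - T * (Y * X)) =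
      (X * Y * T - X * T * Y + Y * T * X - T * (Y * X)) * Y := by
  have hX' : ∀ S : R, X * (X * S) = a • S := fun S => by rw [← mul_assoc, hX, smul_mul_assoc, one_mul]
  have hY' : ∀ S : R, Y * (Y * S) = b • S := fun S => by rw [← mul_assoc, hY, smul_mul_assoc, one_mul]
  have hYX : Y * X = c • 1 - X * Y := by rw [← hc]; abel
  have hYX' : ∀ S : R, Y * (X * S) = c • S - X * (Y * S) := fun S => by
    rw [← mul_assoc, hYX, sub_mul, smul_mul_assoc, one_mul, mul_assoc]
  constructor <;>
  · simp only [mul_sub, mul_add, sub_mul, add_mul, mul_assoc, hX, hX', hY, hY', hYX, hYX',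
      mul_smul_comm, smul_mul_assoc, mul_one]
    module

/-- Evaluating at rank-one `T` turns scalarity into a vector identity in `p`, `q`, `w`. Once the
scalars are shown to vanish, fixing `q = w` reads off the relation. -/
theorem mul_eq_linear_of_casimir_scalar {X Y : Matrix (Fin 4) (Fin 4) ℝ}
    (h : ∀ T, ∃ c : ℝ, X * Y * T - X * T * Y + Y * T * X - T * (Y * X) = c • 1) :
    ∃ α β γ : ℝ, X * Y = α • X + β • Y + γ • 1 := by
  choose f hf using h
  have key : ∀ p q w : Fin 4 → ℝ, (q ⬝ᵥ w) • ((X * Y) *ᵥ p) - (q ⬝ᵥ (Y *ᵥ w)) • (X *ᵥ p)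
      + (q ⬝ᵥ (X *ᵥ w)) • (Y *ᵥ p) - (q ⬝ᵥ ((Y * X) *ᵥ w)) • p = f (vecMulVec p q) • w := by
    intro p q w
    have h := congrArg (· *ᵥ w) (hf (vecMulVec p q))
    have h1 := mul_vecMulVec_mul_mulVec (X * Y) 1 p q w
    have h2 := mul_vecMulVec_mul_mulVec 1 (Y * X) p q w
    rw [mul_one, one_mulVec] at h1
    rw [one_mul, one_mulVec] at h2
    simp only [sub_mulVec, add_mulVec, mul_vecMulVec_mul_mulVec, h1, h2, smul_mulVec,
      one_mulVec] at h
    exact h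
  have hzero : ∀ p q, f (vecMulVec p q) = 0 := by
    by_contra! hne
    obtain ⟨p, q, hpq⟩ := hne
    let L := Matrix.toLin' (Matrix.of ![q, q ᵥ* Y, q ᵥ* X, q ᵥ* (Y * X)])
    have hL : ∀ w, L w = ![q ⬝ᵥ w, q ⬝ᵥ (Y *ᵥ w), q ⬝ᵥ (X *ᵥ w), q ⬝ᵥ ((Y * X) *ᵥ w)] := by
      intro w
      simp only [L, toLin'_apply, dotProduct_mulVec]
      ext i
      fin_cases i <;> rfl
    have hinj : Function.Injective L := by
      rw [← LinearMap.ker_eq_bot, LinearMap.ker_eq_bot']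
      intro w hw
      rw [hL] at hw
      have h0 : q ⬝ᵥ w = 0 := congrFun hw 0
      have h1 : q ⬝ᵥ (Y *ᵥ w) = 0 := congrFun hw 1
      have h2 : q ⬝ᵥ (X *ᵥ w) = 0 := congrFun hw 2
      have h3 : q ⬝ᵥ ((Y * X) *ᵥ w) = 0 := congrFun hw 3
      have h := key p q w
      rw [h0, h1, h2, h3] at h
      simp only [zero_smul, sub_zero, add_zero] at h
      exact (smul_eq_zero.1 h.symm).resolve_left hpq
    -- Four functionals on a 4-dimensional space: injectivity gives surjectivity. This `w` makes
    -- every `p` a multiple of `w`, which is absurd.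
    obtain ⟨w, hw⟩ := LinearMap.injective_iff_surjective.1 hinj ![0, 0, 0, -1]
    rw [hL] at hw
    have h0 : q ⬝ᵥ w = 0 := congrFun hw 0
    have h1 : q ⬝ᵥ (Y *ᵥ w) = 0 := congrFun hw 1
    have h2 : q ⬝ᵥ (X *ᵥ w) = 0 := congrFun hw 2
    have h3 : q ⬝ᵥ ((Y * X) *ᵥ w) = -1 := congrFun hw 3
    have hall : ∀ p, p = f (vecMulVec p q) • w := fun p => by
      rw [← key, h0, h1, h2, h3]
      module
    have h00 : 1 = f (vecMulVec (Pi.single 0 1) q) * w 0 := by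
      simpa using congrFun (hall (Pi.single 0 1)) 0
    have h01 : 0 = f (vecMulVec (Pi.single 0 1) q) * w 1 := by
      simpa using congrFun (hall (Pi.single 0 1)) 1
    have h11 : 1 = f (vecMulVec (Pi.single 1 1) q) * w 1 := by
      simpa using congrFun (hall (Pi.single 1 1)) 1
    rcases mul_eq_zero.1 h01.symm with h | h
    · rw [h, zero_mul] at h00
      exact one_ne_zero h00
    · rw [h, mul_zero] at h11
      exact one_ne_zero h11
  let e : Fin 4 → ℝ := Pi.single 0 1
  have he : e ⬝ᵥ e = 1 := by simp [e]
  refine ⟨e ⬝ᵥ (Y *ᵥ e), -(e ⬝ᵥ (X *ᵥ e)), e ⬝ᵥ ((Y * X) *ᵥ e), ?_⟩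
  refine Matrix.mulVec_injective (funext fun p => ?_)
  have h := key p e e
  rw [hzero, he, zero_smul, one_smul] at h
  simp only [add_mulVec, smul_mulVec, one_mulVec]
  rw [← sub_eq_zero, ← h]
  module

/-- Two matrices with zero product that span, together with `1`, an algebra in which `P²` is a
nonzero multiple of `P` have a common non-scalar commuting matrix. -/
theorem exists_commute_of_mul_eq_zero {P Q : Matrix (Fin 4) (Fin 4) ℝ} {s t : ℝ}
    (hP : P * P = s • P) (hQ : Q * Q = t • Q) (hPQ : P * Q = 0)
    (hQP : Q * P = t • P + s • Q - (s * t) • 1) (hs : s ≠ 0) (hne : Q * P ≠ 0) :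
    ∃ C : Matrix (Fin 4) (Fin 4) ℝ, (∀ c : ℝ, C ≠ c • 1) ∧ P * C = C * P ∧ Q * C = C * Q := by
  -- By `hQP`, `D` equals `(P - s)(Q - t)`; hence its one-sided multiplication rules, which make `D
  -- * T * (P - s • 1) - P * T * D` commute with `P` and `Q` for every `T`.
  set D := -(Q * P) with hD
  have hPD : P * D = 0 := by rw [hD, mul_neg, ← mul_assoc, hPQ, zero_mul, neg_zero]
  have hDQ : D * Q = 0 := by rw [hD, neg_mul, mul_assoc, hPQ, mul_zero, neg_zero]
  have hDP : D * P = s • D := by rw [hD, neg_mul, mul_assoc, hP, mul_smul_comm, smul_neg]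
  have hQD : Q * D = t • D := by rw [hD, mul_neg, ← mul_assoc, hQ, smul_mul_assoc, smul_neg]
  have hQP' : Q * P = -D := by rw [hD, neg_neg]
  have hDe : D = (s * t) • 1 - t • P - s • Q := by rw [hD, hQP]; abel
  have hcomm : ∀ T, P * (D * T * (P - s • 1) - P * T * D) = (D * T * (P - s • 1) - P * T * D) * P ∧
      Q * (D * T * (P - s • 1) - P * T * D) = (D * T * (P - s • 1) - P * T * D) * Q := by
    intro T
    have e1 : P * (D * T * (P - s • 1) - P * T * D) = -(s • (P * T * D)) := by
      simp only [mul_sub, ← mul_assoc, hPD, hP, zero_mul, smul_mul_assoc, zero_sub, mul_smul_comm,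
        mul_one, smul_zero]
      abel
    have e2 : (D * T * (P - s • 1) - P * T * D) * P = -(s • (P * T * D)) := by
      have h0 : (P - s • 1) * P = 0 := by
        rw [sub_mul, hP, smul_mul_assoc, one_mul, sub_self]
      rw [sub_mul, mul_assoc _ _ P, h0, mul_zero, mul_assoc _ D, hDP, mul_smul_comm, zero_sub]
    have e3 : Q * (D * T * (P - s • 1) - P * T * D) = t • (D * T * (P - s • 1)) + D * T * D := by
      simp only [mul_sub Q, ← mul_assoc, hQD, hQP', smul_mul_assoc, neg_mul]
      abel
    have e4 : (D * T * (P - s • 1) - P * T * D) * Q = -(s • (D * T * Q)) := by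
      simp only [sub_mul, mul_sub, mul_assoc, hPQ, hDQ, smul_mul_assoc, one_mul, mul_zero]
      simp
    refine ⟨e1.trans e2.symm, e3.trans (Eq.trans ?_ e4.symm)⟩
    have : D * T * D = D * T * ((s * t) • 1 - t • P - s • Q) := by rw [← hDe]
    rw [this]
    simp only [mul_sub, mul_smul_comm, mul_one]
    module
  by_contra! hall
  have hsc : ∀ T, ∃ c : ℝ, D * T * (P - s • 1) - P * T * D = c • 1 := by
    intro T
    by_contra! hT
    exact hall _ hT (hcomm T).1 (hcomm T).2
  have hz : ∀ p q w, (q ⬝ᵥ (D *ᵥ w)) • (P *ᵥ p) = 0 := by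
    intro p q
    obtain ⟨c, hc⟩ := hsc (vecMulVec p q)
    have hc0 : c = 0 := by
      -- Two functionals on a 4-dimensional space share a nonzero zero, so the scalar is 0.
      let L := Matrix.toLin' (Matrix.of ![q ᵥ* (P - s • 1), q ᵥ* D])
      have hk : LinearMap.ker L ≠ ⊥ := L.ker_ne_bot_of_finrank_lt (by simp)
      obtain ⟨w, hw, hw0⟩ := Submodule.exists_mem_ne_zero_of_ne_bot hk
      rw [LinearMap.mem_ker, toLin'_apply] at hw
      have h0 : q ⬝ᵥ ((P - s • 1) *ᵥ w) = 0 := by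
        rw [dotProduct_mulVec]; exact congrFun hw 0
      have h1 : q ⬝ᵥ (D *ᵥ w) = 0 := by
        rw [dotProduct_mulVec]; exact congrFun hw 1
      have h := congrArg (· *ᵥ w) hc
      rw [sub_mulVec, mul_vecMulVec_mul_mulVec, mul_vecMulVec_mul_mulVec, h0, h1] at h
      simp only [zero_smul, sub_zero, smul_mulVec, one_mulVec] at h
      exact (smul_eq_zero.1 h.symm).resolve_right hw0
    intro w
    have h := congrArg (P * ·) hc
    simp only [mul_sub, ← mul_assoc, hPD, hP, hc0, zero_mul, zero_smul, mul_zero, zero_sub,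
      smul_mul_assoc, mul_smul_comm, smul_zero, neg_eq_zero, sub_zero] at h
    have h := (smul_eq_zero.1 h).resolve_left hs
    rw [← mul_vecMulVec_mul_mulVec, h, zero_mulVec]
  have hD0 : D ≠ 0 := by rw [hD]; exact neg_ne_zero.2 hne
  have hP0 : P ≠ 0 := by rintro rfl; simp at hne
  apply hP0
  refine Matrix.mulVec_injective (funext fun p => ?_)
  obtain ⟨w, hw⟩ : ∃ w, D *ᵥ w ≠ 0 := by
    by_contra! h
    exact hD0 (Matrix.mulVec_injective (funext fun w => by rw [h, zero_mulVec]))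
  have h := hz p (D *ᵥ w) w
  rw [zero_mulVec]
  exact (smul_eq_zero.1 h).resolve_left (fun h => hw (dotProduct_self_eq_zero.1 h))

theorem exists_commute_of_mul_eq_linear {X Y : Matrix (Fin 4) (Fin 4) ℝ} {a b c α β γ : ℝ}
    (hXs : ∀ c : ℝ, X ≠ c • 1) (hYs : ∀ c : ℝ, Y ≠ c • 1)
    (hX : X * X = a • 1) (hY : Y * Y = b • 1) (hc : X * Y + Y * X = c • 1)
    (hXY : X * Y = α • X + β • Y + γ • 1) :
    ∃ C : Matrix (Fin 4) (Fin 4) ℝ, (∀ c : ℝ, C ≠ c • 1) ∧ X * C = C * X ∧ Y * C = C * Y := by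
  by_cases hcom : X * Y = Y * X
  · exact ⟨X, hXs, rfl, hcom.symm⟩
  set P := X - β • (1 : Matrix (Fin 4) (Fin 4) ℝ) with hP
  set Q := Y - α • (1 : Matrix (Fin 4) (Fin 4) ℝ) with hQ
  have hXP : X = P + β • 1 := by rw [hP]; abel
  have hYQ : Y = Q + α • 1 := by rw [hQ]; abel
  have hP0 : P ≠ 0 := fun h => hXs β (by rw [hXP, h, zero_add])
  have hQ0 : Q ≠ 0 := fun h => hYs α (by rw [hYQ, h, zero_add])
  have hPQ : P * Q = (γ + α * β) • 1 := by
    simp only [hP, hQ, sub_mul, mul_sub, hXY, smul_mul_assoc, mul_smul_comm, one_mul, mul_one]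
    module
  have hPQne : P * Q ≠ Q * P := by
    intro h
    apply hcom
    rw [hXP, hYQ]
    simp only [add_mul, mul_add, h, smul_mul_assoc, mul_smul_comm, one_mul, mul_one]
    module
  -- Otherwise `Q` would be a multiple of the inverse of `P` and commute with it.
  have hδ : γ + α * β = 0 := by
    by_contra hδ
    apply hPQne
    have h1 : P * ((γ + α * β)⁻¹ • Q) = 1 := by
      rw [mul_smul_comm, hPQ, smul_smul, inv_mul_cancel₀ hδ, one_smul]
    have h2 := _root_.mul_eq_one_comm.1 h1
    rw [← h1, smul_mul_assoc, mul_smul_comm] at h2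
    exact (smul_right_injective _ (inv_ne_zero hδ) h2).symm
  rw [hδ, zero_smul] at hPQ
  have hPP : P * P = (-2 * β) • P + (a - β ^ 2) • 1 := by
    simp only [hP, sub_mul, mul_sub, hX, smul_mul_assoc, mul_smul_comm, one_mul, mul_one]
    module
  have hQQ : Q * Q = (-2 * α) • Q + (b - α ^ 2) • 1 := by
    simp only [hQ, sub_mul, mul_sub, hY, smul_mul_assoc, mul_smul_comm, one_mul, mul_one]
    module
  have ha : a - β ^ 2 = 0 := by
    have h := congrArg (· * Q) hPP
    simp only [mul_assoc, add_mul, hPQ, mul_zero, smul_mul_assoc, one_mul, smul_zero,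
      zero_add] at h
    exact (smul_eq_zero.1 h.symm).resolve_right hQ0
  have hb : b - α ^ 2 = 0 := by
    have h := congrArg (P * ·) hQQ
    simp only [← mul_assoc, mul_add, hPQ, zero_mul, mul_smul_comm, mul_one, smul_zero,
      zero_add] at h
    exact (smul_eq_zero.1 h.symm).resolve_right hP0
  rw [ha, zero_smul, add_zero] at hPP
  rw [hb, zero_smul, add_zero] at hQQ
  set s := -2 * β with hs
  set t := -2 * α with ht
  have hQPz : ∃ z : ℝ, Q * P = t • P + s • Q + z • 1 := by
    refine ⟨c - 2 * α * β, ?_⟩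
    have h : P * Q + Q * P = t • P + s • Q + (c - 2 * α * β) • 1 := by
      have : P * Q + Q * P = (X * Y + Y * X) - (2 * α) • X - (2 * β) • Y + (2 * α * β) • 1 := by
        simp only [hP, hQ, sub_mul, mul_sub, smul_mul_assoc, mul_smul_comm, one_mul, mul_one]
        module
      rw [this, hc, hXP, hYQ, hs, ht]
      module
    rwa [hPQ, zero_add] at h
  obtain ⟨z, hz⟩ := hQPz
  have hz' : z = -(s * t) := by
    have h := congrArg (P * ·) hz
    simp only [← mul_assoc, hPQ, zero_mul, mul_add, mul_smul_comm, mul_one, hPP, smul_zero,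
      add_zero, smul_smul, ← add_smul] at h
    have := (smul_eq_zero.1 h.symm).resolve_right hP0
    linarith
  rw [hz', neg_smul, ← sub_eq_add_neg] at hz
  have hQPne : Q * P ≠ 0 := fun h => hPQne (hPQ.trans h.symm)
  suffices ∃ C : Matrix (Fin 4) (Fin 4) ℝ, (∀ c : ℝ, C ≠ c • 1) ∧ P * C = C * P ∧
      Q * C = C * Q by
    obtain ⟨C, hC, h1, h2⟩ := this
    refine ⟨C, hC, ?_, ?_⟩
    · rw [hXP, add_mul, mul_add, h1, smul_mul_assoc, mul_smul_comm, one_mul, mul_one]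
    · rw [hYQ, add_mul, mul_add, h2, smul_mul_assoc, mul_smul_comm, one_mul, mul_one]
  -- Transposition reverses products, exchanging `P`, `s` with `Q`, `t`; `s` and `t` cannot both
  -- vanish since `Q * P ≠ 0`.
  by_cases hs0 : s = 0
  · have ht0 : t ≠ 0 := by
      intro ht0
      rw [hs0, ht0] at hz
      exact hQPne (by rw [hz]; simp)
    have htr : ∀ U V W : Matrix (Fin 4) (Fin 4) ℝ, U * V = W → Vᵀ * Uᵀ = Wᵀ := by
      rintro U V W rfl
      exact (transpose_mul U V).symm
    have hne : Pᵀ * Qᵀ ≠ 0 := by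
      rw [← transpose_mul]
      exact fun h => hQPne (transpose_eq_zero.1 h)
    obtain ⟨C, hC, h1, h2⟩ := exists_commute_of_mul_eq_zero (P := Qᵀ) (Q := Pᵀ) (s := t) (t := s)
      (by simpa using htr _ _ _ hQQ) (by simpa using htr _ _ _ hPP) (by simpa using htr _ _ _ hPQ)
      (by
        rw [htr _ _ _ hz]
        simp only [transpose_sub, transpose_add, transpose_smul, transpose_one]
        module) ht0 hne
    refine ⟨Cᵀ, fun c h => hC c ?_, ?_, ?_⟩
    · rw [← transpose_transpose C, h, transpose_smul, transpose_one]
    · simpa using (congrArg transpose h2).symm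
    · simpa using (congrArg transpose h1).symm
  · exact exists_commute_of_mul_eq_zero hPP hQQ hPQ hz hs0 hQPne

theorem exists_commute_of_quadratic {X Y : Matrix (Fin 4) (Fin 4) ℝ}
    (hXs : ∀ c : ℝ, X ≠ c • 1) (hYs : ∀ c : ℝ, Y ≠ c • 1)
    (hX : ∃ a b : ℝ, X * X = a • X + b • 1) (hY : ∃ a b : ℝ, Y * Y = a • Y + b • 1) :
    ∃ C : Matrix (Fin 4) (Fin 4) ℝ, (∀ c : ℝ, C ≠ c • 1) ∧ X * C = C * X ∧ Y * C = C * Y := by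
  obtain ⟨a, b, hX⟩ := hX
  obtain ⟨a', b', hY⟩ := hY
  set P := X - (a / 2) • (1 : Matrix (Fin 4) (Fin 4) ℝ) with hP
  set Q := Y - (a' / 2) • (1 : Matrix (Fin 4) (Fin 4) ℝ) with hQ
  have hXP : X = P + (a / 2) • 1 := by rw [hP]; abel
  have hYQ : Y = Q + (a' / 2) • 1 := by rw [hQ]; abel
  have hPs : ∀ c : ℝ, P ≠ c • 1 := fun c h => hXs (c + a / 2) (by rw [hXP, h, add_smul])
  have hQs : ∀ c : ℝ, Q ≠ c • 1 := fun c h => hYs (c + a' / 2) (by rw [hYQ, h, add_smul])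
  have hPP : P * P = (b + a ^ 2 / 4) • 1 := by
    simp only [hP, sub_mul, mul_sub, hX, smul_mul_assoc, mul_smul_comm, one_mul, mul_one]
    module
  have hQQ : Q * Q = (b' + a' ^ 2 / 4) • 1 := by
    simp only [hQ, sub_mul, mul_sub, hY, smul_mul_assoc, mul_smul_comm, one_mul, mul_one]
    module
  suffices ∃ C : Matrix (Fin 4) (Fin 4) ℝ, (∀ c : ℝ, C ≠ c • 1) ∧ P * C = C * P ∧
      Q * C = C * Q by
    obtain ⟨C, hC, h1, h2⟩ := this
    refine ⟨C, hC, ?_, ?_⟩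
    · rw [hXP, add_mul, mul_add, h1, smul_mul_assoc, mul_smul_comm, one_mul, mul_one]
    · rw [hYQ, add_mul, mul_add, h2, smul_mul_assoc, mul_smul_comm, one_mul, mul_one]
  by_cases hZ : ∃ c : ℝ, P * Q + Q * P = c • 1
  · obtain ⟨c, hc⟩ := hZ
    by_cases hT : ∀ T, ∃ c : ℝ, P * Q * T - P * T * Q + Q * T * P - T * (Q * P) = c • 1
    · obtain ⟨α, β, γ, h⟩ := mul_eq_linear_of_casimir_scalar hT
      exact exists_commute_of_mul_eq_linear hPs hQs hPP hQQ hc h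
    · push Not at hT
      obtain ⟨T, hT⟩ := hT
      exact ⟨_, hT, casimir_commute hPP hQQ hc T⟩
  · push Not at hZ
    refine ⟨_, hZ, ?_, ?_⟩
    · rw [mul_add, add_mul, ← mul_assoc, hPP, mul_assoc Q, hPP, smul_mul_assoc, mul_smul_comm,
        one_mul, mul_one, mul_assoc, add_comm]
    · rw [mul_add, add_mul, ← mul_assoc Q Q P, hQQ, mul_assoc P Q Q, hQQ, smul_mul_assoc,
        mul_smul_comm, one_mul, mul_one, mul_assoc, add_comm]

/-! ### Two matrices at distance at least four. -/

/-- A nilpotent Jordan block. -/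
def jordanBlock : Matrix (Fin 4) (Fin 4) ℝ :=
  !![0, 1, 0, 0; 0, 0, 1, 0; 0, 0, 0, 1; 0, 0, 0, 0]

/-- A matrix with minimal polynomial `(x² + 1)²`, in general position to `jordanBlock`. -/
def complexJordanBlock : Matrix (Fin 4) (Fin 4) ℝ :=
  !![0, -1, -1, 0; 1, 0, 0, -1; 0, 0, 0, 1; 0, 2, 1, 0]

/-- `X` is upper triangular Toeplitz. If it is not scalar, `Y` preserves the kernel of `X - X 0 0`,
a proper coordinate subspace spanned by the first one, two or three basis vectors; general position
then makes `Y` scalar. -/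
theorem eq_smul_one_of_commute_chain {X Y : Matrix (Fin 4) (Fin 4) ℝ}
    (hX : jordanBlock * X = X * jordanBlock)
    (hY : Y * complexJordanBlock = complexJordanBlock * Y)
    (hXY : X * Y = Y * X) :
    (∃ c : ℝ, X = c • 1) ∨ ∃ c : ℝ, Y = c • 1 := by
  have hx := fun i j => congrFun (congrFun hX i) j
  have hy := fun i j => congrFun (congrFun hY i) j
  have hxy := fun i j => congrFun (congrFun hXY i) j
  simp [jordanBlock, complexJordanBlock, mul_apply, Fin.sum_univ_four, Fin.forall_fin_succ] at hx hy hxy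
  obtain ⟨⟨x10, x11, x12, x13⟩, ⟨x20, x21, x22, x23⟩, ⟨x30, x31, x32, x33⟩, -⟩ := hx
  rw [x10] at x21
  rw [x11] at x22
  rw [x12] at x23
  rw [x20] at x31
  rw [x21] at x32
  rw [x22] at x33
  have hXs (h1 : X 0 1 = 0) (h2 : X 0 2 = 0) (h3 : X 0 3 = 0) : ∃ c : ℝ, X = c • 1 := by
    refine ⟨X 0 0, ?_⟩
    ext i j
    fin_cases i <;> fin_cases j <;>
      simp [x10, x11, x12, x13, x20, x21, x22, x23, x30, x31, x32, x33, h1, h2, h3]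
  simp only [x10, x11, x12, x13, x20, x21, x22, x23, x30, x31, x32, x33, zero_mul, mul_zero,
    zero_add, add_zero] at hxy
  obtain ⟨⟨a1, a2, a3, -⟩, ⟨b1, b2, b3, -⟩, ⟨c1, -, -, -⟩, -⟩ := hxy
  obtain ⟨⟨p1, p2, p3, p4⟩, ⟨q1, q2, q3, q4⟩, ⟨r1, r2, r3, r4⟩, s1, s2, s3, s4⟩ := hy
  -- The first basis vector is cyclic for `complexJordanBlock`, so the first column of `Y`
  -- determines `Y`.
  have hYs (h1 : Y 1 0 = 0) (h2 : Y 2 0 = 0) (h3 : Y 3 0 = 0) : ∃ c : ℝ, Y = c • 1 := by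
    clear a1 a2 a3 b1 b2 b3 c1
    refine ⟨Y 0 0, ?_⟩
    ext i j
    fin_cases i <;> fin_cases j <;> simp <;> linarith
  by_cases h1 : X 0 1 = 0
  · simp only [h1, zero_mul, mul_zero, zero_add, add_zero] at a1 a2 a3 b1 b2 b3
    by_cases h2 : X 0 2 = 0
    · simp only [h2, zero_mul, mul_zero, zero_add, add_zero] at a1 a2 a3
      by_cases h3 : X 0 3 = 0
      · exact Or.inl (hXs h1 h2 h3)
      · right
        have e1 : Y 3 0 = 0 := mul_left_cancel₀ h3 (by linarith)
        have e2 : Y 3 1 = 0 := mul_left_cancel₀ h3 (by linarith)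
        have e3 : Y 3 2 = 0 := mul_left_cancel₀ h3 (by linarith)
        clear a1 a2 a3 b1 b2 b3 c1
        exact hYs (by linarith) (by linarith) e1
    · right
      have e1 : Y 3 0 = 0 := mul_left_cancel₀ h2 (by linarith)
      have e2 : Y 3 1 = 0 := mul_left_cancel₀ h2 (by linarith)
      have e3 : Y 2 0 = 0 := mul_left_cancel₀ h2 (by rw [e1] at a1; linarith)
      exact hYs (by linarith) e3 e1
  · right
    have e1 : Y 3 0 = 0 := mul_left_cancel₀ h1 (by linarith)
    have e2 : Y 2 0 = 0 := mul_left_cancel₀ h1 (by rw [e1] at b1; linarith)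
    have e3 : Y 1 0 = 0 := mul_left_cancel₀ h1 (by rw [e1, e2] at a1; linarith)
    exact hYs e3 e2 e1

/-! ### Translation into graph distance. -/

theorem commutingGraph_edist_le_one {R : Type*} [Ring R] {a b : {x : R // x ∉ Set.center R}}
    (h : (a : R) * b = b * a) : (commutingGraph R).edist a b ≤ 1 := by
  rw [SimpleGraph.edist_le_one_iff_adj_or_eq]
  by_cases hab : a = b
  · exact Or.inr hab
  · exact Or.inl ⟨hab, h⟩

theorem exists_commute_chain_of_edist_lt_four {R : Type*} [Ring R]
    {a b : {x : R // x ∉ Set.center R}} (h : (commutingGraph R).edist a b < 4) :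
    ∃ x y : {x : R // x ∉ Set.center R},
      (a : R) * x = x * a ∧ (x : R) * y = y * x ∧ (y : R) * b = b * y := by
  obtain ⟨w, hw⟩ := SimpleGraph.exists_walk_of_edist_ne_top (ne_top_of_lt h)
  rw [← hw] at h
  have hlen : w.length < 4 := by exact_mod_cast h
  clear hw h
  -- Shorter walks are padded by repeating vertices, as each element commutes with itself.
  match w, hlen with
  | .nil, _ => exact ⟨a, a, rfl, rfl, rfl⟩
  | .cons h1 .nil, _ => exact ⟨a, a, rfl, rfl, h1.2⟩
  | .cons (v := x) h1 (.cons h2 .nil), _ => exact ⟨x, x, h1.2, rfl, h2.2⟩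
  | .cons (v := x) h1 (.cons (v := y) h2 (.cons h3 .nil)), _ => exact ⟨x, y, h1.2, h2.2, h3.2⟩
  | .cons _ (.cons _ (.cons _ (.cons _ _))), hlen =>
    simp only [SimpleGraph.Walk.length_cons] at hlen
    omega

theorem jordanBlock_notMem_center : jordanBlock ∉ Set.center (Matrix (Fin 4) (Fin 4) ℝ) := by
  rw [mem_center_iff_exists_smul_one]
  rintro ⟨c, hc⟩
  have := congrFun (congrFun hc 0) 1
  simp [jordanBlock] at this

theorem complexJordanBlock_notMem_center :
    complexJordanBlock ∉ Set.center (Matrix (Fin 4) (Fin 4) ℝ) := by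
  rw [mem_center_iff_exists_smul_one]
  rintro ⟨c, hc⟩
  have := congrFun (congrFun hc 1) 0
  simp [complexJordanBlock] at this

theorem commutingGraph_edist_le_four (A B : {x // x ∉ Set.center (Matrix (Fin 4) (Fin 4) ℝ)}) :
    (commutingGraph (Matrix (Fin 4) (Fin 4) ℝ)).edist A B ≤ 4 := by
  have hA := A.2
  have hB := B.2
  rw [mem_center_iff_exists_smul_one] at hA hB
  push Not at hA hB
  obtain ⟨X, hXs, hAX, hX⟩ := exists_commute_quadratic A.1 (Algebra.IsIntegral.isIntegral _) hA
  obtain ⟨Y, hYs, hBY, hY⟩ := exists_commute_quadratic B.1 (Algebra.IsIntegral.isIntegral _) hB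
  obtain ⟨C, hCs, hXC, hYC⟩ := exists_commute_of_quadratic hXs hYs hX hY
  have hmem : ∀ {Z : Matrix (Fin 4) (Fin 4) ℝ}, (∀ c : ℝ, Z ≠ c • 1) → Z ∉ Set.center _ :=
    fun h h' => (mem_center_iff_exists_smul_one.1 h').elim h
  let X' : {x // x ∉ Set.center (Matrix (Fin 4) (Fin 4) ℝ)} := ⟨X, hmem hXs⟩
  let Y' : {x // x ∉ Set.center (Matrix (Fin 4) (Fin 4) ℝ)} := ⟨Y, hmem hYs⟩
  let C' : {x // x ∉ Set.center (Matrix (Fin 4) (Fin 4) ℝ)} := ⟨C, hmem hCs⟩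
  set G := commutingGraph (Matrix (Fin 4) (Fin 4) ℝ)
  have h1 : G.edist A X' ≤ 1 := commutingGraph_edist_le_one hAX
  have h2 : G.edist X' C' ≤ 1 := commutingGraph_edist_le_one hXC
  have h3 : G.edist C' Y' ≤ 1 := commutingGraph_edist_le_one hYC.symm
  have h4 : G.edist Y' B ≤ 1 := commutingGraph_edist_le_one hBY.symm
  calc G.edist A B ≤ G.edist A C' + G.edist C' B := G.edist_triangle
    _ ≤ (G.edist A X' + G.edist X' C') + (G.edist C' Y' + G.edist Y' B) :=
      add_le_add G.edist_triangle G.edist_triangle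
    _ ≤ (1 + 1) + (1 + 1) := add_le_add (add_le_add h1 h2) (add_le_add h3 h4)
    _ = 4 := by norm_num

theorem mainTheorem1 :
    (commutingGraph (Matrix (Fin 4) (Fin 4) ℝ)).ediam = 4 := by
  refine le_antisymm (SimpleGraph.ediam_le_of_edist_le commutingGraph_edist_le_four) ?_
  refine le_trans ?_ (SimpleGraph.edist_le_ediam
    (u := ⟨jordanBlock, jordanBlock_notMem_center⟩)
    (v := ⟨complexJordanBlock, complexJordanBlock_notMem_center⟩))
  by_contra! h
  obtain ⟨X, Y, h1, h2, h3⟩ := exists_commute_chain_of_edist_lt_four h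
  rcases eq_smul_one_of_commute_chain h1 h3 h2 with h | h
  · exact X.2 (mem_center_iff_exists_smul_one.2 h)
  · exact Y.2 (mem_center_iff_exists_smul_one.2 h)
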